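/- Let $p$ be a prime and let $G$ be a finite group with a split $BN$-pair of characteristic $p$ (for example, a finite group of Lie type defined in characteristic $p$). That is, $G$ has a $BN$-pair $(B,N)$ such that, with $T=B\cap N$ and $U$ the largest normal $p$-subgroup of $B$, the group $T$ is abelian, $B=U\rtimes T$, and $\bigcap_{n\in N}nBn^{-1}=T$. Let $W=N/T$ be the Weyl group. Let $k$ be an algebraically closed field of characteristic $r>0$ with $r\neq p$. For a one-dimensional $kT$-module $X$, let ${\rm Irr}_k(G|(T,X))$ denote the principal series of $X$: the irreducible $kG$-modules $Y$ such that $X$ is a composition factor of the $kT$-module $Y^U$ of $U$-fixed points (the Harish-Chandra restriction of $Y$ to $T$). Assume that $r\nmid |B|$. If $X$ is a one-dimensional $kT$-module and $Y$ and $V$ are irreducible $kG$-modules which both belong to ${\rm Irr}_k(G|(T,X))$, then $$\dim_k {\rm Ext}^1_{kG}(Y,V)\leq |W|.$$ -/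

import Mathlib

open CategoryTheory
open scoped Pointwise

universe u v w

/-- A `BN`-pair (Tits system) in a group `G`: subgroups `B` and `N` and a set `S` of elements of
`W = N / (B ∩ N)` satisfying the usual axioms. -/
structure BNPair (G : Type v) [Group G] where
  B : Subgroup G
  N : Subgroup G
  /-- `G` is generated by `B` and `N`. -/
  sup_eq_top : B ⊔ N = ⊤
  /-- `B ∩ N` is normal in `N`. -/
  [normal : ((B ⊓ N).subgroupOf N).Normal]
  /-- The distinguished generators of `W = N / (B ∩ N)`. -/
  S : Set (N ⧸ (B ⊓ N).subgroupOf N)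
  closure_S : Subgroup.closure S = ⊤
  orderOf_S : ∀ s ∈ S, orderOf s = 2
  /-- `n B n⁻¹ ≠ B` whenever `n` represents an element of `S`. -/
  conj_ne : ∀ n : N, (n : N ⧸ (B ⊓ N).subgroupOf N) ∈ S → MulAut.conj (n : G) • B ≠ B
  /-- `n B m ⊆ B n m B ∪ B m B` whenever `n` represents an element of `S` and `m ∈ N`. -/
  mul_mem : ∀ n : N, (n : N ⧸ (B ⊓ N).subgroupOf N) ∈ S → ∀ m : N, ∀ b ∈ B,
    (n : G) * b * m ∈ DoubleCoset.doubleCoset ((n : G) * m) (B : Set G) (B : Set G) ∪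
      DoubleCoset.doubleCoset (m : G) (B : Set G) (B : Set G)

/-- The torus `T = B ∩ N`. -/
abbrev BNPair.T {G : Type v} [Group G] (D : BNPair G) : Subgroup G := D.B ⊓ D.N

/-- The Weyl group `W = N / T`. -/
abbrev BNPair.W {G : Type v} [Group G] (D : BNPair G) : Type v := D.N ⧸ D.T.subgroupOf D.N

/-- A split `BN`-pair of characteristic `p`: `B = U ⋊ T`, where `U` is the largest normal
`p`-subgroup of `B` and `T = B ∩ N` is abelian, and the intersection of the `N`-conjugates of `B`
is `T`. -/
structure SplitBNPair (p : ℕ) (G : Type v) [Group G] extends BNPair G where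
  U : Subgroup G
  U_le_B : U ≤ B
  U_normal : (U.subgroupOf B).Normal
  U_isPGroup : IsPGroup p U
  U_largest : ∀ Q : Subgroup G, Q ≤ B → (Q.subgroupOf B).Normal → IsPGroup p Q → Q ≤ U
  U_sup_T : U ⊔ (B ⊓ N) = B
  U_inf_T : U ⊓ (B ⊓ N) = ⊥
  T_comm : ∀ s ∈ B ⊓ N, ∀ t ∈ B ⊓ N, s * t = t * s
  iInf_conj : ⨅ n : N, MulAut.conj (n : G) • B = B ⊓ N

section

variable {k : Type u} [Field k]

/-- `σ` is a composition factor of `ρ`: it is irreducible and isomorphic to a subquotient of `ρ`,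
i.e. it is a quotient of a subrepresentation of `ρ`. -/
def IsCompositionFactor {H : Type v} [Group H] {X : Type*} [AddCommGroup X] [Module k X]
    {M : Type*} [AddCommGroup M] [Module k M]
    (σ : Representation k H X) (ρ : Representation k H M) : Prop :=
  σ.IsIrreducible ∧ ∃ (A : Subrepresentation ρ) (f : A.toRepresentation.IntertwiningMap σ),
    Function.Surjective f

variable {p : ℕ} {G : Type v} [Group G] (D : SplitBNPair p G)

/-- The `U`-fixed points are stable under `T`, since `T ≤ B` normalizes `U`. -/
theorem SplitBNPair.invariants_le_comap {M : Type*} [AddCommGroup M] [Module k M]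
    (ρ : Representation k G M) (t : D.T) :
    Representation.invariants (ρ.comp D.U.subtype) ≤
      (Representation.invariants (ρ.comp D.U.subtype)).comap ((ρ.comp D.T.subtype) t) := by
  rintro x hx ⟨y, hy⟩
  have ht : (t : G) ∈ D.B := t.2.1
  have h := D.U_normal.conj_mem ⟨y, D.U_le_B hy⟩ hy ⟨(t : G)⁻¹, inv_mem ht⟩
  have h' : (t : G)⁻¹ * y * t ∈ D.U := by
    simpa [Subgroup.mem_subgroupOf] using h
  have hx' : ρ ((t : G)⁻¹ * y * t) x = x := hx ⟨_, h'⟩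
  change ρ y (ρ t x) = ρ t x
  conv_rhs => rw [← hx']
  rw [← Module.End.mul_apply, ← Module.End.mul_apply, ← map_mul, ← map_mul]
  congr 2
  group

/-- Harish-Chandra restriction `*R_T^G`: the representation of `T` on the `U`-fixed points. -/
noncomputable def SplitBNPair.hcRestriction {M : Type*} [AddCommGroup M] [Module k M]
    (ρ : Representation k G M) : Representation k D.T (Representation.invariants (ρ.comp D.U.subtype)) :=
  Representation.subrepresentation (ρ.comp D.T.subtype) _ (D.invariants_le_comap ρ)

/-- Membership in the principal series `Irr_k(G | (T, X))`: the representation `ρ` of `G` is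
irreducible and `X` is a composition factor of its Harish-Chandra restriction to `T`. (The
requirement that `T` be minimal among the Levi subgroups with nonzero Harish-Chandra restriction
is automatic, because every `N`-conjugate of a standard Levi subgroup contains `T`.) -/
def SplitBNPair.InPrincipalSeries {X : Type*} [AddCommGroup X] [Module k X]
    (σ : Representation k D.T X) {M : Type*} [AddCommGroup M] [Module k M]
    (ρ : Representation k G M) : Prop :=
  ρ.IsIrreducible ∧ IsCompositionFactor σ (D.hcRestriction ρ)

end

/-- Ext-groups exist in the category of representations, as it has enough projectives. -/
instance Rep.hasExt (k : Type u) (G : Type v) [Field k] [Group G] :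
    HasExt.{max u v} (Rep.{max u v} k G) :=
  haveI : EnoughProjectives (Rep.{max u v} k G) :=
    Rep.equivalenceModuleMonoidAlgebra.enoughProjectives_iff.2
      ModuleCat.enoughProjectives.{max u v}
  hasExt_of_enoughProjectives _

/-!
Since `|B|` is invertible in `k`, so is `|T|`, and `X` embeds in the `U`-fixed points of `Y`. Its
image is stable under `B`, so by Frobenius reciprocity `Y` is a quotient of `P = Ind_B^G X`, which
is projective because every `kB`-module is. If `K` is the kernel of `P → Y`, then `Hom_G(K, V)`
maps onto `Ext¹(Y, V)`. Likewise `V`, restricted to `B`, has a copy of `X` as a direct summand;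
composing with the projection onto it embeds `Hom_G(K, V)` in `Hom_B(K, X)`, because `V` is
irreducible. By Maschke's theorem `K` is a direct summand of `P` over `B`, so `Hom_B(P, X)` maps
onto `Hom_B(K, X)`. Finally a `B`-map out of `Ind_B^G X` is determined by its values on
representatives of `B \ G / B`, and the Bruhat decomposition `G = BNB` bounds the number of these
double cosets by `|W|`.
-/

section Maschke

variable {k H X M : Type*} [Field k] [Group H] [AddCommGroup X] [Module k X] [AddCommGroup M]
  [Module k M] {σ : Representation k H X} {ρ : Representation k H M}

/-- The inclusion of a subrepresentation, as an intertwining map. -/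
def subrepresentationInclusion (A : Subrepresentation ρ) :
    A.toRepresentation.IntertwiningMap ρ where
  toLinearMap := A.toSubmodule.subtype
  isIntertwining' _ := rfl

variable [Finite H] [NeZero (Nat.card H : k)]

theorem exists_intertwiningMap_leftInverse (f : σ.IntertwiningMap ρ) (hf : Function.Injective f) :
    ∃ g : ρ.IntertwiningMap σ, Function.LeftInverse g f := by
  obtain ⟨g, hg⟩ := MonoidAlgebra.exists_leftInverse_of_injective
    (Representation.IntertwiningMap.equivLinearMapAsModule σ ρ f) (LinearMap.ker_eq_bot.2 hf)
  exact ⟨(Representation.IntertwiningMap.equivLinearMapAsModule ρ σ).symm g,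
    LinearMap.congr_fun hg⟩

theorem exists_intertwiningMap_rightInverse (f : ρ.IntertwiningMap σ)
    (hf : Function.Surjective f) : ∃ g : σ.IntertwiningMap ρ, Function.RightInverse g f := by
  have : Module.Projective (MonoidAlgebra k H) σ.asModule :=
    Module.projective_of_isSemisimpleRing ..
  obtain ⟨g, hg⟩ := Module.projective_lifting_property
    (Representation.IntertwiningMap.equivLinearMapAsModule ρ σ f) LinearMap.id hf
  exact ⟨(Representation.IntertwiningMap.equivLinearMapAsModule σ ρ).symm g,
    LinearMap.congr_fun hg⟩

theorem IsCompositionFactor.exists_injective (h : IsCompositionFactor σ ρ) :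
    ∃ f : σ.IntertwiningMap ρ, Function.Injective f := by
  obtain ⟨-, A, f, hf⟩ := h
  obtain ⟨g, hg⟩ := exists_intertwiningMap_rightInverse f hf
  exact ⟨(subrepresentationInclusion A).comp g, Subtype.val_injective.comp hg.injective⟩

theorem isSplitMono_of_mono_rep {X M : Rep.{w} k H} (f : X ⟶ M) [Mono f] : IsSplitMono f := by
  obtain ⟨g, hg⟩ := exists_intertwiningMap_leftInverse f.hom ((Rep.mono_iff_injective f).1 ‹_›)
  exact ⟨⟨Rep.ofHom g, Rep.hom_ext (Representation.IntertwiningMap.ext (LinearMap.ext hg))⟩⟩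

theorem projective_rep (X : Rep.{w} k H) : Projective X where
  factors {E M} f e he := by
    obtain ⟨g, hg⟩ := exists_intertwiningMap_rightInverse e.hom ((Rep.epi_iff_surjective e).1 he)
    exact ⟨f ≫ Rep.ofHom g, Rep.hom_ext (Representation.IntertwiningMap.ext
      (LinearMap.ext fun x => hg (f.hom x)))⟩

end Maschke

section Mackey

theorem indV_mk_mul {k G H X : Type*} [CommRing k] [Group G] [Group H] [AddCommGroup X]
    [Module k X] (φ : H →* G) (σ : Representation k H X) (h : H) (g : G) (x : X) :
    Representation.IndV.mk φ σ (φ h * g) x = Representation.IndV.mk φ σ g (σ h⁻¹ x) := by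
  simp

theorem intertwiningMap_comp_subtype_ind_ext {k G X Z : Type*} [CommRing k] [Group G]
    {H K : Subgroup G} [AddCommGroup X] [Module k X] [AddCommGroup Z] [Module k Z]
    {σ : Representation k H X} {τ : Representation k K Z}
    {f f' : Representation.IntertwiningMap ((σ.ind H.subtype).comp K.subtype) τ}
    (hff' : ∀ q : DoubleCoset.Quotient (H : Set G) (K : Set G),
      f.toLinearMap ∘ₗ Representation.IndV.mk H.subtype σ q.out =
        f'.toLinearMap ∘ₗ Representation.IndV.mk H.subtype σ q.out) : f = f' := by
  refine Representation.IntertwiningMap.ext (Representation.IndV.hom_ext _ _ fun g =>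
    LinearMap.ext fun x => ?_)
  obtain ⟨h, κ, hh, hκ, hout⟩ := DoubleCoset.mk_out_eq_mul H K g
  set q := DoubleCoset.mk H K g
  have hmk : Representation.IndV.mk H.subtype σ g x =
      ((σ.ind H.subtype).comp K.subtype) ⟨κ, hκ⟩
        (Representation.IndV.mk H.subtype σ q.out (σ ⟨h, hh⟩ x)) := by
    have hg : g = H.subtype ⟨h, hh⟩⁻¹ * q.out * κ⁻¹ := by simp [hout, mul_assoc]
    rw [hg, ← Representation.ind_mk, indV_mk_mul, inv_inv]
    rfl
  change f (Representation.IndV.mk H.subtype σ g x) = f' (Representation.IndV.mk H.subtype σ g x)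
  rw [hmk, f.isIntertwining, f'.isIntertwining]
  exact congrArg (τ _) (LinearMap.congr_fun (hff' q) (σ ⟨h, hh⟩ x))

theorem rank_hom_res_ind_le {k : Type u} [Field k] {G : Type v} [Group G] {H K : Subgroup G}
    [Finite (DoubleCoset.Quotient (H : Set G) (K : Set G))]
    (X : Rep.{max u v} k H) (Z : Rep.{max u v} k K) [Module.Finite k X] [Module.Finite k Z] :
    Module.rank k (Rep.res K.subtype (Rep.ind H.subtype X) ⟶ Z) ≤
      (Nat.card (DoubleCoset.Quotient (H : Set G) (K : Set G)) *
        (Module.finrank k X * Module.finrank k Z) : ℕ) := by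
  let evalOut : (Rep.res K.subtype (Rep.ind H.subtype X) ⟶ Z) →ₗ[k]
      DoubleCoset.Quotient (H : Set G) (K : Set G) → X →ₗ[k] Z :=
    { toFun f q := f.hom.toLinearMap ∘ₗ Representation.IndV.mk H.subtype X.ρ q.out
      map_add' _ _ := rfl
      map_smul' _ _ := rfl }
  have hinj : Function.Injective evalOut := fun f f' hff' =>
    Rep.hom_ext (intertwiningMap_comp_subtype_ind_ext (congrFun hff'))
  cases nonempty_fintype (DoubleCoset.Quotient (H : Set G) (K : Set G))
  calc Module.rank k (Rep.res K.subtype (Rep.ind H.subtype X) ⟶ Z)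
      ≤ Module.rank k (DoubleCoset.Quotient (H : Set G) (K : Set G) → X →ₗ[k] Z) :=
        evalOut.rank_le_of_injective hinj
    _ = _ := by
        rw [← Module.finrank_eq_rank, Module.finrank_pi_fintype]
        simp [Module.finrank_linearMap, Nat.card_eq_fintype_card]

end Mackey

section LinearCategory

variable {k C : Type*} [CommRing k] [Category.{w} C]

theorem rank_hom_le_of_isSplitMono [Preadditive C] [Linear k C] {A E : C} (i : A ⟶ E)
    [IsSplitMono i] (Z : C) : Module.rank k (A ⟶ Z) ≤ Module.rank k (E ⟶ Z) :=
  LinearMap.rank_le_of_surjective (Linear.leftComp k Z i) fun f =>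
    ⟨retraction i ≫ f, by simp⟩

theorem rank_ext_one_le_rank_hom [Abelian C] [Linear k C] [HasExt.{w} C]
    {S : ShortComplex C} (hS : S.ShortExact) [Projective S.X₂] (V : C) :
    Module.rank k (Abelian.Ext.{w} S.X₃ V 1) ≤ Module.rank k (S.X₁ ⟶ V) := by
  refine LinearMap.rank_le_of_surjective
    (Abelian.Ext.precompOfLinear hS.extClass k V (add_zero 1) ∘ₗ
      (Abelian.Ext.linearEquiv₀ (R := k)).symm.toLinearMap) fun x => ?_
  obtain ⟨y, hy⟩ := Abelian.Ext.contravariant_sequence_exact₃ hS V x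
    (Abelian.Ext.eq_zero_of_projective _) (add_zero 1)
  exact ⟨Abelian.Ext.linearEquiv₀ (R := k) y, by simpa using hy⟩

theorem rank_ext_one_le_rank_hom_kernel [Abelian C] [Linear k C] [HasExt.{w} C] {P Y : C}
    (f : P ⟶ Y) [hP : Projective P] [hf : Epi f] (V : C) :
    Module.rank k (Abelian.Ext.{w} Y V 1) ≤ Module.rank k (Limits.kernel f ⟶ V) :=
  have : Projective (ShortComplex.kernelSequence f).X₂ := hP
  have hS : (ShortComplex.kernelSequence f).ShortExact :=
    { exact := ShortComplex.kernelSequence_exact f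
      mono_f := inferInstance
      epi_g := hf }
  rank_ext_one_le_rank_hom hS V

end LinearCategory

section Frobenius

variable {k : Type u} [Field k] {G : Type v} {H : Type*} [Group G] [Group H] (φ : H →* G)

theorem projective_ind [Finite H] [NeZero (Nat.card H : k)] (X : Rep.{max u v} k H) :
    Projective (Rep.ind φ X) :=
  (Rep.indResAdjunction k φ).map_projective X (projective_rep X)

theorem epi_indResHomEquiv_symm {X : Rep.{max u v} k H} {Y : Rep.{max u v} k G}
    (hY : Y.ρ.IsIrreducible) {j : X ⟶ Rep.res φ Y} (hj : j ≠ 0) :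
    Epi ((Rep.indResHomEquiv φ X Y).symm j) := by
  rw [Rep.epi_iff_surjective]
  refine (Representation.IsIrreducible.surjective_or_eq_zero _).resolve_right fun h => hj ?_
  exact (LinearEquiv.map_eq_zero_iff _).1 (Rep.hom_ext h)

theorem rank_hom_le_rank_hom_res {V : Rep.{w} k G} (hV : V.ρ.IsIrreducible) {Z : Rep.{w} k H}
    {l : Rep.res φ V ⟶ Z} (hl : l ≠ 0) (A : Rep.{w} k G) :
    Module.rank k (A ⟶ V) ≤ Module.rank k (Rep.res φ A ⟶ Z) := by
  refine LinearMap.rank_le_of_injective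
    (Linear.rightComp k (Rep.res φ A) l ∘ₗ (Rep.resFunctor φ).mapLinearMap k)
    ((injective_iff_map_eq_zero _).2 fun f hf => ?_)
  rcases Representation.IsIrreducible.surjective_or_eq_zero f.hom with hsurj | hzero
  · have : Epi ((Rep.resFunctor φ).mapLinearMap k f) := (Rep.epi_iff_surjective _).2 hsurj
    exact (hl ((cancel_epi _).1 (hf.trans Limits.comp_zero.symm))).elim
  · exact Rep.hom_ext hzero

end Frobenius

section ExtBound

variable {k : Type u} [Field k] {G : Type v} [Group G] {H K : Subgroup G}

theorem rank_ext_one_le [Finite H] [Finite K] [NeZero (Nat.card H : k)] [NeZero (Nat.card K : k)]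
    [Finite (DoubleCoset.Quotient (H : Set G) (K : Set G))]
    {Y V : Rep.{max u v} k G} (hY : Y.ρ.IsIrreducible) (hV : V.ρ.IsIrreducible)
    {X : Rep.{max u v} k H} {Z : Rep.{max u v} k K} [Module.Finite k X] [Module.Finite k Z]
    {j : X ⟶ Rep.res H.subtype Y} (hj : j ≠ 0) {l : Rep.res K.subtype V ⟶ Z} (hl : l ≠ 0) :
    Module.rank k (Abelian.Ext.{max u v} Y V 1) ≤
      (Nat.card (DoubleCoset.Quotient (H : Set G) (K : Set G)) *
        (Module.finrank k X * Module.finrank k Z) : ℕ) := by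
  let π := (Rep.indResHomEquiv H.subtype X Y).symm j
  have := projective_ind H.subtype X
  have : Epi π := epi_indResHomEquiv_symm H.subtype hY hj
  let ι := (Rep.resFunctor K.subtype).map (Limits.kernel.ι π)
  have : Mono ι := (Rep.resFunctor K.subtype).map_mono _
  have : IsSplitMono ι := isSplitMono_of_mono_rep ι
  calc Module.rank k (Abelian.Ext.{max u v} Y V 1)
      ≤ Module.rank k (Limits.kernel π ⟶ V) := rank_ext_one_le_rank_hom_kernel π V
    _ ≤ Module.rank k (Rep.res K.subtype (Limits.kernel π) ⟶ Z) :=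
        rank_hom_le_rank_hom_res K.subtype hV hl _
    _ ≤ Module.rank k (Rep.res K.subtype (Rep.ind H.subtype X) ⟶ Z) :=
        rank_hom_le_of_isSplitMono ι Z
    _ ≤ _ := rank_hom_res_ind_le X Z

theorem rank_ext_one_le_of_subrepresentation [Finite H] [Finite K] [NeZero (Nat.card H : k)]
    [NeZero (Nat.card K : k)] [Finite (DoubleCoset.Quotient (H : Set G) (K : Set G))]
    {Y V : Rep.{max u v} k G} (hY : Y.ρ.IsIrreducible) (hV : V.ρ.IsIrreducible)
    (A : Subrepresentation (Rep.res H.subtype Y).ρ) (C : Subrepresentation (Rep.res K.subtype V).ρ)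
    [Module.Finite k A.toSubmodule] [Module.Finite k C.toSubmodule]
    [Nontrivial A.toSubmodule] [Nontrivial C.toSubmodule] :
    Module.rank k (Abelian.Ext.{max u v} Y V 1) ≤
      (Nat.card (DoubleCoset.Quotient (H : Set G) (K : Set G)) *
        (Module.finrank k A.toSubmodule * Module.finrank k C.toSubmodule) : ℕ) := by
  obtain ⟨l, hl⟩ := exists_intertwiningMap_leftInverse (subrepresentationInclusion C)
    Subtype.val_injective
  let j : Rep.of A.toRepresentation ⟶ Rep.res H.subtype Y :=
    Rep.ofHom (subrepresentationInclusion A)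
  let q : Rep.res K.subtype V ⟶ Rep.of C.toRepresentation := Rep.ofHom l
  have hj : j ≠ 0 := fun hj0 => by
    obtain ⟨a, ha⟩ := exists_ne (0 : A.toSubmodule)
    exact ha (Subtype.ext (congrArg (fun f => f.hom a) hj0))
  have hq : q ≠ 0 := fun hq0 => by
    obtain ⟨c, hc⟩ := exists_ne (0 : C.toSubmodule)
    exact hc ((hl c).symm.trans (congrArg (fun f => f.hom (c : V)) hq0))
  exact (rank_ext_one_le hY hV hj hq :)

end ExtBound

section Bruhat

variable {G : Type v} [Group G] (D : BNPair G)

theorem BNPair.eq_top_of_B_le {P : Subgroup G} (hB : D.B ≤ P)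
    (hS : ∀ n : D.N, (n : D.W) ∈ D.S → (n : G) ∈ P) : P = ⊤ := by
  have := D.normal
  have hW : (P.subgroupOf D.N).map (QuotientGroup.mk' (D.T.subgroupOf D.N)) = ⊤ := by
    rw [eq_top_iff, ← D.closure_S, Subgroup.closure_le]
    intro s hs
    obtain ⟨n, rfl⟩ := QuotientGroup.mk_surjective s
    exact ⟨n, hS n hs, rfl⟩
  rw [eq_top_iff, ← D.sup_eq_top]
  refine sup_le hB fun n hn => ?_
  obtain ⟨m, hm, hmn⟩ := hW.ge (Subgroup.mem_top (QuotientGroup.mk ⟨n, hn⟩ : D.W))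
  have hT : m⁻¹ * ⟨n, hn⟩ ∈ D.T.subgroupOf D.N := QuotientGroup.eq.1 hmn
  exact (P.mul_mem_cancel_left (inv_mem hm)).1 (hB hT.1)

theorem BNPair.mul_mem_B_mul_N_mul_B {n : D.N} (hn : (n : D.W) ∈ D.S) {g : G}
    (hg : g ∈ (D.B * D.N * D.B : Set G)) : (n * g : G) ∈ (D.B * D.N * D.B : Set G) := by
  obtain ⟨-, ⟨b, hb, m, hm, rfl⟩, b', hb', rfl⟩ := hg
  have hmul : ∀ x ∈ (D.B * D.N * D.B : Set G), x * b' ∈ (D.B * D.N * D.B : Set G) := by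
    rintro - ⟨y, hy, c, hc, rfl⟩
    exact ⟨y, hy, c * b', D.B.mul_mem hc hb', (mul_assoc y c b').symm⟩
  have hsub : ∀ m' ∈ D.N,
      DoubleCoset.doubleCoset m' (D.B : Set G) (D.B : Set G) ⊆ D.B * D.N * D.B := fun m' hm' =>
    Set.mul_subset_mul_right (Set.mul_subset_mul_left (Set.singleton_subset_iff.2 hm'))
  have hnbm : (n * b * m : G) ∈ (D.B * D.N * D.B : Set G) :=
    (D.mul_mem n hn ⟨m, hm⟩ b hb).elim (hsub _ (D.N.mul_mem n.2 hm) ·) (hsub m hm ·)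
  simpa only [mul_assoc] using hmul _ hnbm

theorem BNPair.B_mul_N_mul_B : (D.B * D.N * D.B : Set G) = Set.univ := by
  have := D.normal
  have hstab : MulAction.stabilizer G (D.B * D.N * D.B : Set G) = ⊤ := by
    refine D.eq_top_of_B_le (fun b hb => ?_) fun n hn => MulAction.mem_stabilizer_set.2 fun g =>
      ⟨fun hg => ?_, D.mul_mem_B_mul_N_mul_B hn⟩
    · rw [MulAction.mem_stabilizer_iff, ← smul_mul_assoc, ← smul_mul_assoc, smul_coe_set hb]
    · have hsq : (n : D.W) ^ 2 = 1 := orderOf_dvd_iff_pow_eq_one.1 (D.orderOf_S _ hn).dvd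
      have hinv : (n : D.W)⁻¹ = n := inv_eq_of_mul_eq_one_left (by rwa [← sq])
      have hn' : ((n⁻¹ : D.N) : D.W) ∈ D.S := by rwa [QuotientGroup.mk_inv, hinv]
      simpa using D.mul_mem_B_mul_N_mul_B hn' hg
  have hone : (1 : G) ∈ (D.B * D.N * D.B : Set G) := by
    simpa using Set.mul_mem_mul (Set.mul_mem_mul D.B.one_mem D.N.one_mem) D.B.one_mem
  refine Set.eq_univ_of_forall fun g => ?_
  simpa using (MulAction.mem_stabilizer_set.1 (hstab.ge (Subgroup.mem_top g)) 1).2 hone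

theorem BNPair.natCard_doubleCoset_le [Finite D.W] :
    Nat.card (DoubleCoset.Quotient (D.B : Set G) (D.B : Set G)) ≤ Nat.card D.W := by
  refine Nat.card_le_card_of_surjective
    (fun w : D.W => DoubleCoset.mk D.B D.B (w.out : G)) fun q => ?_
  obtain ⟨-, ⟨b, hb, n, hn, rfl⟩, b', hb', hq⟩ := D.B_mul_N_mul_B.ge (Set.mem_univ q.out)
  obtain ⟨t, ht⟩ := QuotientGroup.mk_out_eq_mul (D.T.subgroupOf D.N) ⟨n, hn⟩
  refine ⟨(⟨n, hn⟩ : D.N), ?_⟩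
  rw [← DoubleCoset.out_eq' D.B D.B q, ← hq, DoubleCoset.eq]
  refine ⟨b, hb, t⁻¹ * b', D.B.mul_mem (D.B.inv_mem t.2.1) hb', ?_⟩
  simp [ht, mul_assoc]

end Bruhat

section PrincipalSeries

theorem moduleFinite_of_isIrreducible {k H X : Type*} [Field k] [Group H] [Finite H]
    [AddCommGroup X] [Module k X] (σ : Representation k H X) [σ.IsIrreducible] :
    Module.Finite k X :=
  have : Module.Finite k σ.asModule := Module.Finite.trans (MonoidAlgebra k H) σ.asModule
  this

variable {k : Type u} [Field k] {p : ℕ} {G : Type v} [Group G] (D : SplitBNPair p G)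

theorem SplitBNPair.exists_mul_eq_of_mem_B {b : G} (hb : b ∈ D.B) :
    ∃ y : D.U, ∃ t : D.T, (y * t : G) = b := by
  have hT : D.T ≤ Subgroup.normalizer (D.U : Set G) :=
    inf_le_left.trans ((Subgroup.normal_subgroupOf_iff_le_normalizer D.U_le_B).1 D.U_normal)
  have hUT : (D.U * D.T : Set G) = D.B := by
    rw [← Subgroup.coe_mul_of_right_le_normalizer_left D.U D.T hT, D.U_sup_T]
  obtain ⟨y, hy, t, ht, hyt⟩ := hUT.ge hb
  exact ⟨⟨y, hy⟩, ⟨t, ht⟩, hyt⟩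

/-- The `B`-representation inflated from a `T`-subrepresentation `A` of the Harish-Chandra
restriction of `ρ`, realised inside `ρ`: as a subspace it is `A` itself. -/
noncomputable def SplitBNPair.inflateSubrepresentation {M : Type*} [AddCommGroup M] [Module k M]
    {ρ : Representation k G M} (A : Subrepresentation (D.hcRestriction ρ)) :
    Subrepresentation (ρ.comp D.B.subtype : Representation k D.B M) where
  toSubmodule := A.toSubmodule.map (Representation.invariants (ρ.comp D.U.subtype)).subtype
  apply_mem_toSubmodule b := by
    rintro - ⟨a, ha, rfl⟩
    obtain ⟨y, t, hyt⟩ := D.exists_mul_eq_of_mem_B b.2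
    have hb : ρ b a = D.hcRestriction ρ t a := by
      rw [← hyt, map_mul]
      exact (D.hcRestriction ρ t a).2 y
    exact ⟨D.hcRestriction ρ t a, A.apply_mem_toSubmodule t ha, hb.symm⟩

variable {D} in
theorem SplitBNPair.InPrincipalSeries.exists_subrepresentation [Finite D.T]
    [NeZero (Nat.card D.T : k)] {X M : Type*} [AddCommGroup X] [Module k X] [AddCommGroup M]
    [Module k M] {σ : Representation k D.T X} {ρ : Representation k G M}
    (h : D.InPrincipalSeries σ ρ) :
    ∃ A : Subrepresentation (ρ.comp D.B.subtype : Representation k D.B M),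
      Nontrivial A.toSubmodule ∧ Module.Finite k A.toSubmodule ∧
        Module.finrank k A.toSubmodule = Module.finrank k X := by
  obtain ⟨f, hf⟩ := h.2.exists_injective
  let A := D.inflateSubrepresentation f.range
  let e : X ≃ₗ[k] A.toSubmodule := (LinearEquiv.ofInjective f.toLinearMap hf).trans
    (Submodule.equivMapOfInjective _ (Submodule.injective_subtype _) _)
  have := h.2.1
  have : Nontrivial X := IsSimpleModule.nontrivial (MonoidAlgebra k D.T) σ.asModule
  have := moduleFinite_of_isIrreducible σ
  exact ⟨A, e.symm.nontrivial, Module.Finite.equiv e, e.finrank_eq.symm⟩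

end PrincipalSeries

theorem mainTheorem7_general {p : ℕ} {k : Type u} [Field k] {G : Type v} [Group G] [Finite G]
    (D : SplitBNPair p G) (hB : (Nat.card D.B : k) ≠ 0)
    {X X' : Type*} [AddCommGroup X] [Module k X] [AddCommGroup X'] [Module k X']
    (σ : Representation k D.T X) (σ' : Representation k D.T X') (Y V : Rep.{max u v} k G)
    (hY : D.InPrincipalSeries σ Y.ρ) (hV : D.InPrincipalSeries σ' V.ρ) :
    Module.rank k (Abelian.Ext.{max u v} Y V 1) ≤
      (Nat.card D.W * (Module.finrank k X * Module.finrank k X') : ℕ) := by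
  have : NeZero (Nat.card D.B : k) := ⟨hB⟩
  have : NeZero (Nat.card D.T : k) := ⟨fun h => hB <| by
    obtain ⟨m, hm⟩ := Subgroup.card_dvd_of_le (inf_le_left : D.T ≤ D.B)
    rw [hm, Nat.cast_mul, h, zero_mul]⟩
  have : Finite (DoubleCoset.Quotient (D.B : Set G) (D.B : Set G)) := Quotient.finite _
  obtain ⟨A, _, _, hA⟩ := hY.exists_subrepresentation
  obtain ⟨C, _, _, hC⟩ := hV.exists_subrepresentation
  refine (rank_ext_one_le_of_subrepresentation hY.1 hV.1 A C).trans ?_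
  rw [hA, hC]
  exact_mod_cast Nat.mul_le_mul_right _ D.natCard_doubleCoset_le

theorem mainTheorem7 {p r : ℕ} (hp : p.Prime) (hr : 0 < r) (hrp : r ≠ p)
    {k : Type u} [Field k] [IsAlgClosed k] [CharP k r]
    {G : Type v} [Group G] [Finite G] (D : SplitBNPair p G)
    (hB : ¬ r ∣ Nat.card D.B)
    {X : Type w} [AddCommGroup X] [Module k X] (σ : Representation k D.T X)
    (hX : Module.finrank k X = 1)
    (Y V : Rep.{max u v} k G)
    (hY : D.InPrincipalSeries σ Y.ρ) (hV : D.InPrincipalSeries σ V.ρ) :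
    Module.rank k (Abelian.Ext.{max u v} Y V 1) ≤ (Nat.card D.W : Cardinal) := by
  simpa [hX] using
    mainTheorem7_general D (mt (CharP.cast_eq_zero_iff k r _).1 hB) σ σ Y V hY hV
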